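/- Let $n \ge 3$ and $1 \le k < n$ be integers, and set $$\beta = \frac{(n-k)(n-k-1)}{n(n-1)}, \qquad (n)_k = n(n-1)\cdots(n-k+1).$$ For a partition $\lambda$ of $n$ let $\dim(\lambda)$ be the dimension of the irreducible complex representation of the symmetric group $S_n$ parameterized by $\lambda$ (the Specht module), and let $\pi(\lambda) = \dim(\lambda)^2/n!$ be the Plancherel measure. Let $\mathrm{Ind}_{S_{n-k}}^{S_n}(1)$ be the representation of $S_n$ induced from the trivial representation of the subgroup $S_{n-k}$ that fixes $k$ of the $n$ symbols, let $\otimes^r$ denote the $r$-fold tensor power of a representation, and let $\mathrm{Mult}(\lambda, V)$ be the multiplicity of the irreducible representation parameterized by $\lambda$ in $V$. Then for every integer $r \ge 0$, $$\sum_{|\lambda| = n} \left| \frac{n!\,\mathrm{Mult}\big(\lambda, \otimes^r \mathrm{Ind}_{S_{n-k}}^{S_n}(1)\big)}{\dim(\lambda)\,\big((n)_k\big)^r} - 1 \right|^2 \pi(\lambda) \;\le\; n!\,\beta^{2r}.$$ Moreover, for every real $c$ and every integer $r \ge 0$ with $$r > \frac{n\log n + c}{2\log(1/\beta)},$$ the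 sum on the left-hand side is at most $\sqrt{2\pi}\,e^{-c}$. (Here $\log$ is the natural logarithm; if $k = n-1$, so that $\beta = 0$ and $\log(1/\beta) = \infty$, the right-hand side of the condition on $r$ is read as $0$.) -/

import Mathlib

open scoped TensorProduct

noncomputable section

namespace SymmetricGroupRep

/-- The Young diagram of a partition `l` of `n`: the lengths of its rows are the parts of `l`, in
weakly decreasing order. -/
def diagram {n : ℕ} (l : n.Partition) : YoungDiagram :=
  YoungDiagram.ofRowLens (l.parts.sort (· ≥ ·)) (l.parts.pairwise_sort (· ≥ ·)).sortedGE

/-- A Young tableau of shape `l`: a bijection from the symbols `Fin n` to the boxes of the diagram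
of `l` (the symbol `i` is written in the box `t i = (row, column)`). -/
abbrev Tableau {n : ℕ} (l : n.Partition) : Type :=
  Fin n ≃ {b : ℕ × ℕ // b ∈ (diagram l).cells}

/-- The row of `t` that contains the symbol `i`. The function `t.row` records the tabloid `{t}`,
that is, the class of `t` modulo permutations of the symbols within each row. -/
def Tableau.row {n : ℕ} {l : n.Partition} (t : Tableau l) (i : Fin n) : ℕ := (t i).1.1

/-- The column of `t` that contains the symbol `i`. -/
def Tableau.col {n : ℕ} {l : n.Partition} (t : Tableau l) (i : Fin n) : ℕ := (t i).1.2

/-- The complex vector space with basis the functions `f : Fin n → ℕ`. A tabloid is identified with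
the function that sends each symbol to the index of its row, so the tabloids of shape `l`, for
all partitions `l` of `n`, are among these basis vectors. -/
abbrev TabloidSpace (n : ℕ) : Type := (Fin n → ℕ) →₀ ℂ

/-- The permutation representation of `S_n` on `TabloidSpace n`: `g` replaces every symbol `i`
by `g i`, so it sends the basis vector `f` to the basis vector `f ∘ g⁻¹`. -/
def tabloidRep (n : ℕ) : Representation ℂ (Equiv.Perm (Fin n)) (TabloidSpace n) where
  toFun g := Finsupp.lmapDomain ℂ ℂ (fun f i => f (g⁻¹ i))
  map_one' := Finsupp.lhom_ext fun f a => by simp [Finsupp.mapDomain_single]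
  map_mul' g h := Finsupp.lhom_ext fun f a => by simp [Finsupp.mapDomain_single]

/-- The polytabloid `e_t = ∑ sign(q) {q t}`, the sum over the permutations `q` of the symbols that
preserve every column of `t`. -/
def polytabloid {n : ℕ} {l : n.Partition} (t : Tableau l) : TabloidSpace n :=
  ∑ q : Equiv.Perm (Fin n) with ∀ i, t.col (q i) = t.col i,
    Finsupp.single (fun i => t.row (q⁻¹ i)) (((Equiv.Perm.sign q : ℤˣ) : ℤ) : ℂ)

theorem tabloidRep_polytabloid {n : ℕ} {l : n.Partition} (g : Equiv.Perm (Fin n))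
    (t : Tableau l) :
    tabloidRep n g (polytabloid t) = polytabloid (g⁻¹.trans t : Tableau l) := by
  simp only [polytabloid, map_sum]
  refine Finset.sum_bij' (fun q _ => g * q * g⁻¹) (fun q _ => g⁻¹ * q * g) ?_ ?_ ?_ ?_ ?_
  · intro q hq
    simp only [Finset.mem_filter, Finset.mem_univ, true_and] at hq ⊢
    intro i
    simpa [Tableau.col] using hq (g⁻¹ i)
  · intro q hq
    simp only [Finset.mem_filter, Finset.mem_univ, true_and] at hq ⊢
    intro i
    simpa [Tableau.col] using hq (g i)
  · intro q _
    group
  · intro q _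
    group
  · intro q _
    have h : Equiv.Perm.sign (g * q * g⁻¹) = Equiv.Perm.sign q := by
      rw [map_mul, map_mul, mul_right_comm, map_inv, mul_inv_cancel, one_mul]
    rw [h]
    simp [tabloidRep, Finsupp.mapDomain_single, Tableau.row]

/-- The Specht module of `l`, the irreducible complex representation of `S_n` that is parameterized
by the partition `l`: the span of the polytabloids of all tableaux of shape `l`. -/
def specht {n : ℕ} (l : n.Partition) : Subrepresentation (tabloidRep n) where
  toSubmodule := Submodule.span ℂ (Set.range fun t : Tableau l => polytabloid t)
  apply_mem_toSubmodule g v hv := by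
    induction hv using Submodule.span_induction with
    | mem x hx =>
      obtain ⟨t, rfl⟩ := hx
      exact Submodule.subset_span ⟨_, (tabloidRep_polytabloid g t).symm⟩
    | zero => simp
    | add x y _ _ hx hy => rw [map_add]; exact Submodule.add_mem _ hx hy
    | smul a x _ hx => rw [map_smul]; exact Submodule.smul_mem _ _ hx

/-- `dim(l)`, the dimension of the irreducible representation parameterized by `l`. -/
def dim {n : ℕ} (l : n.Partition) : ℕ := Module.finrank ℂ (specht l).toSubmodule

/-- The Plancherel measure of `S_n`: the partition `l` has probability `dim(l)² / n!`. -/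
def plancherel {n : ℕ} (l : n.Partition) : ℝ := (dim l : ℝ) ^ 2 / (n.factorial : ℝ)

/-- The multiplicity of the irreducible representation parameterized by `l` in a complex
representation `ρ` of `S_n`: the dimension of the space of equivariant maps from it to `ρ`. -/
def mult {n : ℕ} (l : n.Partition) {V : Type*} [AddCommGroup V] [Module ℂ V]
    (ρ : Representation ℂ (Equiv.Perm (Fin n)) V) : ℕ :=
  Module.finrank ℂ (Representation.IntertwiningMap (specht l).toRepresentation ρ)

/-- The `r`-fold tensor power of a representation: `g` acts on `V ⊗ ⋯ ⊗ V` by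
`ρ g ⊗ ⋯ ⊗ ρ g`. -/
def tensorPower {G V : Type*} [Group G] [AddCommGroup V] [Module ℂ V]
    (ρ : Representation ℂ G V) (r : ℕ) : Representation ℂ G (⨂[ℂ] _ : Fin r, V) :=
  PiTensorProduct.mapMonoidHom.comp (MonoidHom.pi fun _ => ρ)

/-- The inclusion of `S_{n-k}` in `S_n`, as the permutations that fix the last `k` of the `n`
symbols. -/
def inclusion (n k : ℕ) : Equiv.Perm (Fin (n - k)) →* Equiv.Perm (Fin n) :=
  Equiv.Perm.viaEmbeddingHom (Fin.castLEEmb (Nat.sub_le n k))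

/-- The representation of `S_n` induced from the trivial representation of `S_{n-k}`. -/
def indTrivial (n k : ℕ) : Representation ℂ (Equiv.Perm (Fin n))
    (Representation.IndV (inclusion n k)
      (Representation.trivial ℂ (Equiv.Perm (Fin (n - k))) ℂ)) :=
  Representation.ind (inclusion n k)
    (Representation.trivial ℂ (Equiv.Perm (Fin (n - k))) ℂ)

/-- `β = (n-k)(n-k-1) / (n(n-1))`. -/
def beta (n k : ℕ) : ℝ :=
  (((n : ℝ) - k) * ((n : ℝ) - k - 1)) / ((n : ℝ) * ((n : ℝ) - 1))

/-- The squared `ℓ²(π)` distance between `1` and the function that sends `l` to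
`n! · Mult(l in ⊗^r Ind 1) / (dim(l) · (n(n-1)⋯(n-k+1))^r)`, where `π` is the Plancherel
measure. -/
def weightedSum (n k r : ℕ) : ℝ :=
  ∑ l : n.Partition,
    |((n.factorial : ℝ) * (mult l (tensorPower (indTrivial n k) r) : ℝ)) /
        ((dim l : ℝ) * (n.descFactorial k : ℝ) ^ r) - 1| ^ 2 * plancherel l

end SymmetricGroupRep

end

/-! Let `f g` be the `r`-th power of the normalized character of the induced representation, with
the value at `g = 1` replaced by `0`. That character is the proportion of injections of `k` symbols
into `Fin n` fixed by `g`, and it equals `1` at the identity. By the multiplicity formula, the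
summand of `l` is `(∑ f g * χ_l g)² / n!` when `dim l ≠ 0`: deleting the identity term subtracts
`dim l`, which is the `- 1` of the statement. Bessel's inequality bounds the sum over `l` by `∑ f g
^ 2`. A non-identity permutation has at most `n - 2` fixed points, so each of the `n!` values of `f`
is at most `β ^ r`.

Bessel needs only that distinct Specht characters are orthogonal and that each has norm at most one
(`sum_spechtChar_mul_of_ne`, `sum_spechtChar_mul_self_le`); completeness of the family is not
needed. Both facts come from column antisymmetrizers, with the numerical statistic `weight` in the
role of the dominance order.

For the last claim, `n! ≤ n ^ n` already gives the bound `exp (-c)`, and `√(2π) ≥ 1`. -/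

noncomputable section

namespace SymmetricGroupRep

/-! ### Combinatorics of tableaux: sorting the columns -/

section Columns

variable {n : ℕ} {l m : n.Partition}

theorem card_col_eq (t : Tableau l) (c : ℕ) :
    (Finset.univ.filter fun j => t.col j = c).card = (diagram l).colLen c := by
  rw [YoungDiagram.colLen_eq_card, YoungDiagram.col]
  refine Finset.card_bij (fun j _ => (t j).1) ?_ ?_ ?_
  · intro j hj
    simp only [Finset.mem_filter, Finset.mem_univ, true_and] at hj ⊢
    exact ⟨(t j).2, hj⟩
  · intro i _ j _ h
    exact t.injective (Subtype.ext h)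
  · intro b hb
    simp only [Finset.mem_filter] at hb
    exact ⟨t.symm ⟨b, hb.1⟩, Finset.mem_filter.2
      ⟨Finset.mem_univ _, by simp [Tableau.col, hb.2]⟩, by simp⟩

theorem card_row_eq (t : Tableau l) (c : ℕ) :
    (Finset.univ.filter fun j => t.row j = c).card = (diagram l).rowLen c := by
  rw [YoungDiagram.rowLen_eq_card, YoungDiagram.row]
  refine Finset.card_bij (fun j _ => (t j).1) ?_ ?_ ?_
  · intro j hj
    simp only [Finset.mem_filter, Finset.mem_univ, true_and] at hj ⊢
    exact ⟨(t j).2, hj⟩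
  · intro i _ j _ h
    exact t.injective (Subtype.ext h)
  · intro b hb
    simp only [Finset.mem_filter] at hb
    exact ⟨t.symm ⟨b, hb.1⟩, Finset.mem_filter.2
      ⟨Finset.mem_univ _, by simp [Tableau.row, hb.2]⟩, by simp⟩

/-- The number of symbols in the column of `i` with a smaller value of `f`. -/
def colRank (t : Tableau l) (f : Fin n → ℕ) (i : Fin n) : ℕ :=
  (Finset.univ.filter fun j => t.col j = t.col i ∧ f j < f i).card

theorem colRank_mem (t : Tableau l) (f : Fin n → ℕ) (i : Fin n) :
    (colRank t f i, t.col i) ∈ (diagram l).cells := by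
  rw [YoungDiagram.mem_cells, YoungDiagram.mem_iff_lt_colLen, ← card_col_eq t]
  apply Finset.card_lt_card
  rw [Finset.ssubset_iff_of_subset]
  · exact ⟨i, by simp, by simp⟩
  · intro j
    simp +contextual

theorem colRank_lt (t : Tableau l) {f : Fin n → ℕ} {i j : Fin n} (h : t.col i = t.col j)
    (hf : f i < f j) : colRank t f i < colRank t f j := by
  apply Finset.card_lt_card
  rw [Finset.ssubset_iff_of_subset]
  · exact ⟨i, by simp [h, hf], by simp⟩
  · intro x hx
    simp only [Finset.mem_filter, Finset.mem_univ, true_and] at hx ⊢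
    exact ⟨hx.1.trans h, hx.2.trans hf⟩

/-- Sort each column of `t` by the values of `f`. These values are distinct within a column, so a
symbol with value `f i` has at most `f i` symbols below it in this order. -/
theorem exists_colPerm_row_le (t : Tableau l) (f : Fin n → ℕ)
    (hf : ∀ i j, t.col i = t.col j → f i = f j → i = j) :
    ∃ q : Equiv.Perm (Fin n), (∀ i, t.col (q i) = t.col i) ∧ ∀ i, t.row (q i) ≤ f i := by
  let q : Fin n → Fin n := fun i => t.symm ⟨(colRank t f i, t.col i), colRank_mem t f i⟩
  have hq : Function.Injective q := by
    intro i j hij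
    have h := congrArg Subtype.val (t.symm.injective hij)
    simp only [Prod.mk.injEq] at h
    apply hf i j h.2
    rcases lt_trichotomy (f i) (f j) with h' | h' | h'
    · exact absurd h.1 (colRank_lt t h.2 h').ne
    · exact h'
    · exact absurd h.1 (colRank_lt t h.2.symm h').ne'
  refine ⟨Equiv.ofBijective q (Finite.injective_iff_bijective.1 hq), fun i => ?_, fun i => ?_⟩
  · simp [q, Tableau.col]
  · have : t.row (q i) = colRank t f i := by simp [q, Tableau.row]
    rw [Equiv.ofBijective_apply, this]
    calc colRank t f i ≤ (Finset.range (f i)).card := by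
          refine Finset.card_le_card_of_injOn f ?_ ?_
          · intro j hj
            simp at hj
            simp [hj.2]
          · intro j hj j' hj' h
            simp at hj hj'
            exact hf j j' (hj.1.trans hj'.1.symm) h
      _ = f i := Finset.card_range _

/-- The statistic `∑ i * l_i` of a partition `l`. -/
def weight (l : n.Partition) : ℕ := ∑ b ∈ (diagram l).cells, b.1

theorem sum_row_eq_weight (t : Tableau l) : ∑ i, t.row i = weight l := by
  rw [weight, ← Finset.sum_coe_sort (diagram l).cells fun b => b.1]
  exact Fintype.sum_equiv t _ _ fun i => rfl

theorem diagram_injective : Function.Injective (diagram : n.Partition → YoungDiagram) := by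
  intro l m h
  have key (l : n.Partition) : (diagram l).rowLens = l.parts.sort (· ≥ ·) :=
    YoungDiagram.rowLens_ofRowLens_eq_self fun x hx =>
      l.parts_pos ((Multiset.mem_sort _).1 hx)
  apply Nat.Partition.ext
  rw [← Multiset.sort_eq l.parts (· ≥ ·), ← Multiset.sort_eq m.parts (· ≥ ·), ← key, ← key, h]

theorem eq_of_row_comp (t : Tableau l) (s : Tableau m) (q : Equiv.Perm (Fin n))
    (h : ∀ i, t.row (q i) = s.row i) : l = m := by
  apply diagram_injective
  have hr (c : ℕ) : (diagram l).rowLen c = (diagram m).rowLen c := by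
    rw [← card_row_eq t, ← card_row_eq s]
    symm
    refine Finset.card_bij (fun j _ => q j) ?_ ?_ ?_
    · intro j
      simp [h]
    · intro i _ j _ hij
      exact q.injective hij
    · intro b hb
      exact ⟨q.symm b, by simpa [← h] using hb, by simp⟩
  ext ⟨i, j⟩
  simp [YoungDiagram.mem_cells, YoungDiagram.mem_iff_lt_rowLen, hr]

/-- Column sorting gives a pointwise inequality of row indices. Their totals are the two weights, so
`weight m ≤ weight l` forces equality everywhere. -/
theorem exists_colPerm_row_eq (t : Tableau l) (s : Tableau m)
    (hs : ∀ i j, t.col i = t.col j → s.row i = s.row j → i = j) (hw : weight m ≤ weight l) :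
    ∃ q : Equiv.Perm (Fin n), (∀ i, t.col (q i) = t.col i) ∧ ∀ i, t.row (q i) = s.row i := by
  obtain ⟨q, hq, hle⟩ := exists_colPerm_row_le t s.row hs
  refine ⟨q, hq, fun i => ?_⟩
  have hsum : ∑ i, t.row (q i) = ∑ i, s.row i := by
    apply le_antisymm (Finset.sum_le_sum fun i _ => hle i)
    rw [Equiv.sum_comp q, sum_row_eq_weight, sum_row_eq_weight]
    exact hw
  exact (Finset.sum_eq_sum_iff_of_le fun i _ => hle i).1 hsum i (Finset.mem_univ i)

end Columns

/-! ### Column antisymmetrizers acting on tabloids -/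

section Antisymmetrizer

variable {n : ℕ} {l m : n.Partition}

/-- The permutations of the symbols that preserve every column of `t`. -/
def colPerms (t : Tableau l) : Finset (Equiv.Perm (Fin n)) :=
  Finset.univ.filter fun q => ∀ i, t.col (q i) = t.col i

theorem mem_colPerms {t : Tableau l} {q : Equiv.Perm (Fin n)} :
    q ∈ colPerms t ↔ ∀ i, t.col (q i) = t.col i := by
  simp [colPerms]

theorem mul_mem_colPerms {t : Tableau l} {p q : Equiv.Perm (Fin n)} (hp : p ∈ colPerms t)
    (hq : q ∈ colPerms t) : p * q ∈ colPerms t := by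
  rw [mem_colPerms] at *
  intro i
  rw [Equiv.Perm.mul_apply, hp, hq]

theorem inv_mem_colPerms {t : Tableau l} {q : Equiv.Perm (Fin n)} (hq : q ∈ colPerms t) :
    q⁻¹ ∈ colPerms t := by
  rw [mem_colPerms] at *
  intro i
  simpa using (hq (q⁻¹ i)).symm

/-- The sign of a permutation, as a complex number. -/
def csign (q : Equiv.Perm (Fin n)) : ℂ := ((Equiv.Perm.sign q : ℤˣ) : ℤ)

theorem csign_mul (p q : Equiv.Perm (Fin n)) : csign (p * q) = csign p * csign q := by
  simp [csign]

theorem csign_mul_self (q : Equiv.Perm (Fin n)) : csign q * csign q = 1 := by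
  rw [csign, ← Int.cast_mul, Int.units_coe_mul_self, Int.cast_one]

/-- The column antisymmetrizer of the tableau `t`. -/
def antisymm (t : Tableau l) : TabloidSpace n →ₗ[ℂ] TabloidSpace n :=
  ∑ q ∈ colPerms t, csign q • tabloidRep n q

theorem tabloidRep_single (g : Equiv.Perm (Fin n)) (f : Fin n → ℕ) (a : ℂ) :
    tabloidRep n g (Finsupp.single f a) = Finsupp.single (fun i => f (g⁻¹ i)) a := by
  simp [tabloidRep, Finsupp.mapDomain_single]

theorem antisymm_apply (t : Tableau l) (v : TabloidSpace n) :
    antisymm t v = ∑ q ∈ colPerms t, csign q • tabloidRep n q v := by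
  simp [antisymm]

theorem polytabloid_eq (t : Tableau l) :
    polytabloid t = ∑ q ∈ colPerms t, csign q • Finsupp.single (fun i => t.row (q⁻¹ i)) 1 := by
  simp [polytabloid, colPerms, csign]

theorem antisymm_row (t : Tableau l) :
    antisymm t (Finsupp.single t.row 1) = polytabloid t := by
  simp_rw [antisymm_apply, polytabloid_eq, tabloidRep_single]

theorem antisymm_tabloidRep (t : Tableau l) {p : Equiv.Perm (Fin n)} (hp : p ∈ colPerms t)
    (v : TabloidSpace n) : antisymm t (tabloidRep n p v) = csign p • antisymm t v := by
  rw [antisymm_apply, antisymm_apply, Finset.smul_sum]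
  refine Finset.sum_bij' (fun q _ => q * p) (fun q _ => q * p⁻¹) ?_ ?_ ?_ ?_ ?_
  · intro q hq
    exact mul_mem_colPerms hq hp
  · intro q hq
    exact mul_mem_colPerms hq (inv_mem_colPerms hp)
  · intro q _
    simp
  · intro q _
    simp
  · intro q _
    rw [smul_smul, csign_mul, mul_left_comm, csign_mul_self, mul_one, map_mul,
      Module.End.mul_apply]

/-- The transposition of `i` and `j` is an odd column permutation that fixes the basis vector, so
the image equals its own negative. -/
theorem antisymm_single_eq_zero (t : Tableau l) (f : Fin n → ℕ) {i j : Fin n} (hij : i ≠ j)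
    (hc : t.col i = t.col j) (hf : f i = f j) : antisymm t (Finsupp.single f 1) = 0 := by
  have hs : Equiv.swap i j ∈ colPerms t := by
    rw [mem_colPerms]
    intro x
    rw [Equiv.swap_apply_def]
    split_ifs with h1 h2
    · rw [h1, hc]
    · rw [h2, hc]
    · rfl
  have h := antisymm_tabloidRep t hs (Finsupp.single f 1)
  have hfix : (fun x => f ((Equiv.swap i j)⁻¹ x)) = f := by
    funext x
    rw [Equiv.swap_inv, Equiv.swap_apply_def]
    split_ifs with h1 h2
    · rw [h1, hf]
    · rw [h2, hf]
    · rfl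
  rw [tabloidRep_single, hfix] at h
  have hsign : csign (Equiv.swap i j) = -1 := by simp [csign, Equiv.Perm.sign_swap hij]
  rw [hsign, neg_one_smul] at h
  exact self_eq_neg.1 h

theorem antisymm_polytabloid (t : Tableau l) :
    antisymm t (polytabloid t) = ((colPerms t).card : ℂ) • polytabloid t := by
  rw [polytabloid_eq, map_sum, ← polytabloid_eq, Nat.cast_smul_eq_nsmul]
  refine Finset.sum_eq_card_nsmul fun q hq => ?_
  rw [map_smul, ← tabloidRep_single, antisymm_tabloidRep t hq, smul_smul, csign_mul_self, one_smul,
    antisymm_row]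

theorem card_colPerms_ne_zero (t : Tableau l) : ((colPerms t).card : ℂ) ≠ 0 := by
  rw [Nat.cast_ne_zero]
  exact Finset.card_ne_zero_of_mem (a := 1) (mem_colPerms.2 fun i => rfl)

/-- Either two symbols share a column of `t` and a row of `s`, and the image vanishes, or the rows
of `s` are a column rearrangement of those of `t`, which makes the shapes equal. -/
theorem antisymm_row_of_ne (t : Tableau l) (s : Tableau m) (hw : weight m ≤ weight l)
    (hlm : l ≠ m) : antisymm t (Finsupp.single s.row 1) = 0 := by
  by_cases hs : ∀ i j, t.col i = t.col j → s.row i = s.row j → i = j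
  · obtain ⟨q, -, hq⟩ := exists_colPerm_row_eq t s hs hw
    exact absurd (eq_of_row_comp t s q hq) hlm
  · push Not at hs
    obtain ⟨i, j, hc, hr, hij⟩ := hs
    exact antisymm_single_eq_zero t _ hij hc hr

theorem antisymm_row_mem_span (t s : Tableau l) :
    antisymm t (Finsupp.single s.row 1) ∈ Submodule.span ℂ {polytabloid t} := by
  by_cases hs : ∀ i j, t.col i = t.col j → s.row i = s.row j → i = j
  · obtain ⟨q, hq, hr⟩ := exists_colPerm_row_eq t s hs le_rfl
    have : s.row = fun i => t.row (q⁻¹⁻¹ i) := by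
      funext i
      simp [hr]
    rw [this, ← tabloidRep_single,
      antisymm_tabloidRep t (inv_mem_colPerms (mem_colPerms.2 hq)), antisymm_row]
    exact Submodule.smul_mem _ _ (Submodule.mem_span_singleton_self _)
  · push Not at hs
    obtain ⟨i, j, hc, hr, hij⟩ := hs
    rw [antisymm_single_eq_zero t _ hij hc hr]
    exact Submodule.zero_mem _

theorem specht_le_of_forall_row (P : Submodule ℂ (TabloidSpace n))
    (h : ∀ s : Tableau m, Finsupp.single s.row 1 ∈ P) : (specht m).toSubmodule ≤ P := by
  refine Submodule.span_le.2 ?_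
  rintro _ ⟨s, rfl⟩
  simp only [polytabloid_eq]
  exact Submodule.sum_mem _ fun q _ => Submodule.smul_mem _ _ (h (q⁻¹.trans s : Tableau m))

theorem antisymm_specht_of_ne (t : Tableau l) (hw : weight m ≤ weight l) (hlm : l ≠ m)
    {v : TabloidSpace n} (hv : v ∈ (specht m).toSubmodule) : antisymm t v = 0 :=
  specht_le_of_forall_row (LinearMap.ker (antisymm t))
    (fun s => antisymm_row_of_ne t s hw hlm) hv

theorem antisymm_specht_mem_span (t : Tableau l) {v : TabloidSpace n}
    (hv : v ∈ (specht l).toSubmodule) : antisymm t v ∈ Submodule.span ℂ {polytabloid t} :=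
  specht_le_of_forall_row ((Submodule.span ℂ {polytabloid t}).comap (antisymm t))
    (fun s => antisymm_row_mem_span t s) hv

end Antisymmetrizer

/-! ### Intertwining maps between Specht modules -/

section Homs

variable {n : ℕ} {l m : n.Partition}

/-- The polytabloid of `t`, as an element of the Specht module. -/
def spechtGen (t : Tableau l) : (specht l).toSubmodule :=
  ⟨polytabloid t, Submodule.subset_span ⟨t, rfl⟩⟩

theorem span_spechtGen : Submodule.span ℂ (Set.range (spechtGen (l := l))) = ⊤ := by
  apply Submodule.map_injective_of_injective (specht l).toSubmodule.injective_subtype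
  rw [Submodule.map_span, Submodule.map_top, Submodule.range_subtype, ← Set.range_comp]
  rfl

theorem spechtGen_trans (g : Equiv.Perm (Fin n)) (t : Tableau l) :
    (specht l).toRepresentation g (spechtGen t) = spechtGen (g⁻¹.trans t : Tableau l) :=
  Subtype.ext (tabloidRep_polytabloid g t)

instance : FiniteDimensional ℂ (specht l).toSubmodule :=
  FiniteDimensional.span_of_finite ℂ (Set.finite_range _)

/-- An intertwining map commutes with the antisymmetrizer, which scales the polytabloid of `t` by
the nonzero number of column permutations. Hence the image of that polytabloid lies in the range of
the antisymmetrizer on the target. -/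
theorem antisymm_hom_spechtGen (t : Tableau l)
    (φ : Representation.IntertwiningMap (specht l).toRepresentation (specht m).toRepresentation) :
    antisymm t (φ (spechtGen t)).1 = ((colPerms t).card : ℂ) • (φ (spechtGen t)).1 := by
  have h1 : antisymm t (φ (spechtGen t)).1 =
      (φ (∑ q ∈ colPerms t, csign q • (specht l).toRepresentation q (spechtGen t))).1 := by
    rw [antisymm_apply, map_sum, AddSubmonoidClass.coe_finsetSum]
    refine Finset.sum_congr rfl fun q _ => ?_
    rw [map_smul, φ.isIntertwining]
    rfl
  have h2 : ∑ q ∈ colPerms t, csign q • (specht l).toRepresentation q (spechtGen t) =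
      ((colPerms t).card : ℂ) • spechtGen t := by
    apply Subtype.ext
    rw [AddSubmonoidClass.coe_finsetSum]
    exact (antisymm_apply t _).symm.trans (antisymm_polytabloid t)
  rw [h1, h2, map_smul]
  rfl

theorem hom_ext_spechtGen
    {φ ψ : Representation.IntertwiningMap (specht l).toRepresentation (specht m).toRepresentation}
    (h : ∀ t, φ (spechtGen t) = ψ (spechtGen t)) : φ = ψ := by
  apply Representation.IntertwiningMap.toLinearMap_injective
  apply LinearMap.ext_on_range span_spechtGen h

theorem finrank_hom_specht_of_ne (hw : weight m ≤ weight l) (hlm : l ≠ m) :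
    Module.finrank ℂ (Representation.IntertwiningMap (specht l).toRepresentation
      (specht m).toRepresentation) = 0 := by
  have : Subsingleton (Representation.IntertwiningMap (specht l).toRepresentation
      (specht m).toRepresentation) := by
    refine subsingleton_of_forall_eq 0 fun φ => hom_ext_spechtGen fun t => ?_
    have h := antisymm_hom_spechtGen t φ
    rw [antisymm_specht_of_ne t hw hlm (φ (spechtGen t)).2] at h
    exact Subtype.ext ((smul_eq_zero.1 h.symm).resolve_left (card_colPerms_ne_zero t))
  exact Module.finrank_zero_of_subsingleton

/-- An endomorphism sends one polytabloid to a multiple of itself. The group permutes the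
polytabloids transitively, so the same scalar works for all of them. -/
theorem finrank_end_specht_le_one :
    Module.finrank ℂ (Representation.IntertwiningMap (specht l).toRepresentation
      (specht l).toRepresentation) ≤ 1 := by
  refine finrank_le_one (Representation.IntertwiningMap.id _) fun φ => ?_
  rcases isEmpty_or_nonempty (Tableau l) with he | ⟨⟨t⟩⟩
  · exact ⟨0, hom_ext_spechtGen fun t => he.elim t⟩
  · have h := antisymm_hom_spechtGen t φ
    obtain ⟨c, hc⟩ := Submodule.mem_span_singleton.1
      (antisymm_specht_mem_span t (φ (spechtGen t)).2)
    rw [h] at hc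
    refine ⟨((colPerms t).card : ℂ)⁻¹ * c, hom_ext_spechtGen fun s => ?_⟩
    have hφ : φ (spechtGen t) = (((colPerms t).card : ℂ)⁻¹ * c) • spechtGen t := by
      apply Subtype.ext
      change _ = (((colPerms t).card : ℂ)⁻¹ * c) • polytabloid t
      rw [mul_smul, hc, inv_smul_smul₀ (card_colPerms_ne_zero t)]
    have hs : spechtGen s = (specht l).toRepresentation (t.trans s.symm : Fin n ≃ Fin n)
        (spechtGen t) := by
      rw [spechtGen_trans]
      congr 1
      ext i : 1
      simp [Equiv.Perm.inv_def]
    rw [hs, φ.isIntertwining, hφ, map_smul]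
    simp

end Homs

/-! ### Characters of tensor powers -/

section Traces

/-- The trace of the tensor power of an endomorphism is the power of its trace. -/
theorem trace_piTensorProduct_map {K V ι : Type*} [Field K] [AddCommGroup V] [Module K V]
    [FiniteDimensional K V] [Fintype ι] (f : V →ₗ[K] V) :
    LinearMap.trace K (⨂[K] _ : ι, V) (PiTensorProduct.map fun _ => f) =
      LinearMap.trace K V f ^ Fintype.card ι := by
  classical
  let b := Module.finBasis K V
  rw [LinearMap.trace_eq_matrix_trace K (Basis.piTensorProduct fun _ : ι => b),
    LinearMap.trace_eq_matrix_trace K b]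
  simp only [Matrix.trace, Matrix.diag_apply, LinearMap.toMatrix_apply,
    Basis.piTensorProduct_apply, PiTensorProduct.map_tprod, Basis.piTensorProduct_repr_tprod_apply]
  -- The diagonal entries in the tensor basis are products of diagonal entries of `f`; summing over
  -- all multi-indices expands the power of the trace.
  rw [← Finset.card_univ, ← Finset.prod_const, Finset.prod_univ_sum, Fintype.piFinset_univ]

theorem character_tensorPower {G V : Type*} [Group G] [AddCommGroup V] [Module ℂ V]
    [FiniteDimensional ℂ V] (ρ : Representation ℂ G V) (r : ℕ) (g : G) :
    (tensorPower ρ r).character g = ρ.character g ^ r := by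
  have := trace_piTensorProduct_map (ι := Fin r) (ρ g)
  rw [Fintype.card_fin] at this
  exact this

instance {V : Type*} [AddCommGroup V] [Module ℂ V] [FiniteDimensional ℂ V] (r : ℕ) :
    FiniteDimensional ℂ (⨂[ℂ] _ : Fin r, V) :=
  Module.Finite.of_basis (Basis.piTensorProduct fun _ : Fin r => Module.finBasis ℂ V)

end Traces

/-! ### Real characters, orthogonality and Bessel's inequality -/

section RealCharacters

variable {n : ℕ}

/-- The complex conjugation of the coefficients. -/
def conjTabloid (n : ℕ) : TabloidSpace n →ₛₗ[starRingEnd ℂ] TabloidSpace n :=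
  Finsupp.mapRange.linearMap (starRingEnd ℂ).toSemilinearMap

theorem conjTabloid_single (f : Fin n → ℕ) (a : ℂ) :
    conjTabloid n (Finsupp.single f a) = Finsupp.single f (starRingEnd ℂ a) := by
  simp [conjTabloid]

theorem conjTabloid_polytabloid {l : n.Partition} (t : Tableau l) :
    conjTabloid n (polytabloid t) = polytabloid t := by
  simp [polytabloid, conjTabloid_single]

/-- The characters of the Specht modules are real. -/
theorem conj_character_specht (l : n.Partition) (g : Equiv.Perm (Fin n)) :
    starRingEnd ℂ (Representation.character (V := (specht l).toSubmodule)
      (specht l).toRepresentation g) =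
      Representation.character (V := (specht l).toSubmodule)
      (specht l).toRepresentation g := by
  -- Take a basis consisting of polytabloids. These are fixed by conjugation, so uniqueness of
  -- coordinates makes every polytabloid have real coordinates; the group permutes polytabloids, so
  -- its matrices are real.
  obtain ⟨κ, a, ha, hspan, hli⟩ := exists_linearIndependent' ℂ (spechtGen (l := l))
  have : Finite κ := Finite.of_injective a ha
  have := Fintype.ofFinite κ
  classical
  let b : Module.Basis κ ℂ (specht l).toSubmodule :=
    Module.Basis.mk hli (by rw [hspan, span_spechtGen])
  have hb (i : κ) : b i = spechtGen (a i) := Module.Basis.mk_apply _ _ _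
  have key (t : Tableau l) (i : κ) :
      starRingEnd ℂ (b.repr (spechtGen t) i) = b.repr (spechtGen t) i := by
    have h : ∑ j, starRingEnd ℂ (b.repr (spechtGen t) j) • b j = spechtGen t := by
      have h1 := congrArg (fun v => conjTabloid n v.1) (b.sum_repr (spechtGen t))
      simp only [AddSubmonoidClass.coe_finsetSum, map_sum, Submodule.coe_smul, map_smulₛₗ] at h1
      apply Subtype.ext
      rw [AddSubmonoidClass.coe_finsetSum]
      simp only [hb, spechtGen, conjTabloid_polytabloid] at h1 ⊢
      exact h1
    conv_rhs => rw [← h]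
    rw [b.repr_sum_self]
  rw [Representation.character, LinearMap.trace_eq_matrix_trace ℂ b, Matrix.trace, map_sum]
  refine Finset.sum_congr rfl fun i _ => ?_
  rw [Matrix.diag_apply, LinearMap.toMatrix_apply, hb, spechtGen_trans, key]

/-- The character of the Specht module of `l`, as a real-valued function. -/
def spechtChar (l : n.Partition) (g : Equiv.Perm (Fin n)) : ℝ :=
  (Representation.character (V := (specht l).toSubmodule)
      (specht l).toRepresentation g).re

theorem ofReal_spechtChar (l : n.Partition) (g : Equiv.Perm (Fin n)) :
    (spechtChar l g : ℂ) = Representation.character (V := (specht l).toSubmodule)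
      (specht l).toRepresentation g :=
  Complex.conj_eq_iff_re.1 (conj_character_specht l g)

theorem spechtChar_inv (l : n.Partition) (g : Equiv.Perm (Fin n)) :
    spechtChar l g⁻¹ = spechtChar l g := by
  obtain ⟨c, hc⟩ := isConj_iff.1
    (Equiv.Perm.isConj_iff_cycleType_eq.2 (Equiv.Perm.cycleType_inv g).symm)
  rw [spechtChar, ← hc, Representation.char_conj, spechtChar]

theorem spechtChar_one (l : n.Partition) : spechtChar l 1 = dim l := by
  rw [spechtChar, Representation.char_one]
  rfl

instance : Invertible (Nat.card (Equiv.Perm (Fin n)) : ℂ) :=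
  invertibleOfNonzero (by simp)

theorem sum_character_mul_spechtChar (l : n.Partition) {V : Type*} [AddCommGroup V] [Module ℂ V]
    [FiniteDimensional ℂ V] (ρ : Representation ℂ (Equiv.Perm (Fin n)) V) :
    ∑ g, ρ.character g * spechtChar l g = n.factorial * (mult l ρ : ℂ) := by
  have h := Representation.card_inv_mul_sum_char_mul_char_eq_finrank
    (V := (specht l).toSubmodule) (specht l).toRepresentation ρ
  rw [Nat.card_eq_fintype_card, Fintype.card_perm, Fintype.card_fin, inv_mul_eq_iff_eq_mul₀
    (Nat.cast_ne_zero.2 (Nat.factorial_ne_zero n))] at h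
  rw [mult, ← h]
  refine Finset.sum_congr rfl fun g _ => ?_
  rw [← ofReal_spechtChar, spechtChar_inv]

theorem sum_spechtChar_mul_spechtChar (l m : n.Partition) :
    ∑ g, spechtChar m g * spechtChar l g =
      n.factorial * (mult l (V := (specht m).toSubmodule) (specht m).toRepresentation : ℝ) := by
  have h := sum_character_mul_spechtChar l
    (V := (specht m).toSubmodule) (specht m).toRepresentation
  simp_rw [← ofReal_spechtChar] at h
  exact_mod_cast h

/-- The antisymmetrizer argument kills the intertwining maps in only one direction, fixed by the
weights. The sum is symmetric in `l` and `m`, so either direction suffices. -/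
theorem sum_spechtChar_mul_of_ne {l m : n.Partition} (h : l ≠ m) :
    ∑ g, spechtChar m g * spechtChar l g = 0 := by
  rcases le_total (weight m) (weight l) with hw | hw
  · rw [sum_spechtChar_mul_spechtChar, mult, finrank_hom_specht_of_ne hw h, Nat.cast_zero, mul_zero]
  · simp_rw [mul_comm (spechtChar m _)]
    rw [sum_spechtChar_mul_spechtChar, mult, finrank_hom_specht_of_ne hw h.symm, Nat.cast_zero,
      mul_zero]

theorem sum_spechtChar_mul_self_le (l : n.Partition) :
    ∑ g, spechtChar l g * spechtChar l g ≤ n.factorial := by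
  rw [sum_spechtChar_mul_spechtChar]
  exact mul_le_of_le_one_right (Nat.cast_nonneg _) (Nat.cast_le_one.2 finrank_end_specht_le_one)

/-- Bessel's inequality for the characters of the Specht modules. -/
theorem sum_sq_sum_mul_spechtChar_le (f : Equiv.Perm (Fin n) → ℝ) :
    ∑ l : n.Partition, (∑ g, f g * spechtChar l g) ^ 2 ≤ n.factorial * ∑ g, f g ^ 2 := by
  set N : ℝ := (n.factorial : ℝ) with hN
  have hN0 : 0 < N := Nat.cast_pos.2 n.factorial_pos
  set A : n.Partition → ℝ := fun l => ∑ g, f g * spechtChar l g with hA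
  let P (g : Equiv.Perm (Fin n)) : ℝ := ∑ l, A l * spechtChar l g
  have hcross : ∑ g, f g * P g = ∑ l, A l ^ 2 := by
    simp only [P, Finset.mul_sum]
    rw [Finset.sum_comm]
    refine Finset.sum_congr rfl fun l _ => ?_
    rw [sq, hA, Finset.mul_sum]
    exact Finset.sum_congr rfl fun g _ => by ring
  have hsq : ∑ g, P g ^ 2 ≤ N * ∑ l, A l ^ 2 := by
    calc ∑ g, P g ^ 2 = ∑ l, ∑ m, A l * A m * ∑ g, spechtChar m g * spechtChar l g := by
          simp only [P, sq, Finset.sum_mul_sum]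
          simp only [Finset.mul_sum]
          rw [Finset.sum_comm]
          refine Finset.sum_congr rfl fun l _ => ?_
          rw [Finset.sum_comm]
          exact Finset.sum_congr rfl fun m _ => Finset.sum_congr rfl fun g _ => by ring
      _ = ∑ l, A l * A l * ∑ g, spechtChar l g * spechtChar l g := by
          refine Finset.sum_congr rfl fun l _ => ?_
          refine Finset.sum_eq_single l (fun m _ hm => ?_) (by simp)
          rw [sum_spechtChar_mul_of_ne hm.symm, mul_zero]
      _ ≤ ∑ l, A l * A l * N := Finset.sum_le_sum fun l _ =>
          mul_le_mul_of_nonneg_left (sum_spechtChar_mul_self_le l) (mul_self_nonneg _)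
      _ = N * ∑ l, A l ^ 2 := by
          rw [Finset.mul_sum]
          exact Finset.sum_congr rfl fun l _ => by ring
  -- Since `∑ f P = ∑ A²` and `∑ P² ≤ N ∑ A²`, expanding this nonnegative sum leaves `N ∑ A² ≤ N² ∑
  -- f²`.
  have hpos : 0 ≤ ∑ g, (N * f g - P g) ^ 2 := Finset.sum_nonneg fun g _ => sq_nonneg _
  have hexp : ∑ g, (N * f g - P g) ^ 2 =
      N ^ 2 * ∑ g, f g ^ 2 - 2 * N * ∑ g, f g * P g + ∑ g, P g ^ 2 := by
    rw [Finset.mul_sum, Finset.mul_sum, ← Finset.sum_sub_distrib, ← Finset.sum_add_distrib]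
    exact Finset.sum_congr rfl fun g _ => by ring
  rw [hexp, hcross] at hpos
  refine le_of_mul_le_mul_left ?_ hN0
  linarith

end RealCharacters

/-! ### The induced representation as permutations of injections -/

section Induced

open Representation

variable {n k : ℕ}

/-- The embedding of the last `k` of the `n` symbols. -/
def lastEmb (hkn : k ≤ n) : Fin k ↪ Fin n where
  toFun j := ⟨n - k + j, by omega⟩
  inj' i j h := by
    simp only [Fin.mk.injEq] at h
    omega

theorem inclusion_lastEmb (hkn : k ≤ n) (g : Equiv.Perm (Fin (n - k))) (j : Fin k) :
    inclusion n k g (lastEmb hkn j) = lastEmb hkn j := by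
  rw [inclusion, Equiv.Perm.viaEmbeddingHom_apply]
  apply Equiv.Perm.viaEmbedding_apply_of_notMem
  rintro ⟨i, hi⟩
  have h : (i : ℕ) = n - k + j := congrArg Fin.val hi
  omega

theorem exists_inclusion_eq (hkn : k ≤ n) (p : Equiv.Perm (Fin n))
    (hp : ∀ j, p (lastEmb hkn j) = lastEmb hkn j) : ∃ g, inclusion n k g = p := by
  have hlast (x : Fin n) (hx : ¬ (x : ℕ) < n - k) : p x = x := by
    have : x = lastEmb hkn ⟨x - (n - k), by omega⟩ := Fin.ext (by
      change (x : ℕ) = n - k + (x - (n - k))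
      omega)
    rw [this, hp]
  have hfirst (x : Fin n) : (x : ℕ) < n - k ↔ (p x : ℕ) < n - k := by
    constructor
    · intro hx
      by_contra h
      -- If `p x` were among the last symbols, it would be fixed by `p`, and injectivity would give
      -- `p x = x`.
      exact h ((p.injective (hlast _ h)).symm ▸ hx)
    · intro hx
      by_contra h
      rw [hlast x h] at hx
      exact h hx
  let e : Fin (n - k) ≃ {x : Fin n // (x : ℕ) < n - k} :=
    { toFun i := ⟨Fin.castLE (Nat.sub_le n k) i, i.2⟩
      invFun x := ⟨x.1, x.2⟩
      left_inv _ := rfl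
      right_inv _ := rfl }
  refine ⟨e.trans ((p.subtypePerm fun x => (hfirst x).symm).trans e.symm), ?_⟩
  ext x : 1
  rw [inclusion, Equiv.Perm.viaEmbeddingHom_apply]
  by_cases hx : (x : ℕ) < n - k
  · have : x = Fin.castLEEmb (Nat.sub_le n k) ⟨x, hx⟩ := rfl
    conv_lhs => rw [this, Equiv.Perm.viaEmbedding_apply]
    rfl
  · rw [hlast x hx]
    apply Equiv.Perm.viaEmbedding_apply_of_notMem
    rintro ⟨i, rfl⟩
    exact hx i.2

theorem exists_perm_lastEmb (hkn : k ≤ n) (e : Fin k ↪ Fin n) :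
    ∃ p : Equiv.Perm (Fin n), ∀ j, p (lastEmb hkn j) = e j := by
  classical
  let f := (Equiv.ofInjective _ (lastEmb hkn).injective).symm.trans
    (Equiv.ofInjective _ e.injective)
  refine ⟨f.extendSubtype, fun j => ?_⟩
  rw [Equiv.extendSubtype_apply_of_mem f _ (Set.mem_range_self j)]
  simp [f]

/-- A permutation that sends the last `k` symbols to the values of `e`. -/
def extendEmb (hkn : k ≤ n) (e : Fin k ↪ Fin n) : Equiv.Perm (Fin n) :=
  (exists_perm_lastEmb hkn e).choose

theorem lastEmb_trans_extendEmb (hkn : k ≤ n) (e : Fin k ↪ Fin n) :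
    (lastEmb hkn).trans (extendEmb hkn e).toEmbedding = e :=
  DFunLike.ext _ _ (exists_perm_lastEmb hkn e).choose_spec

/-- The vector of the induced representation that corresponds to a permutation. -/
abbrev indMk (n k : ℕ) (h : Equiv.Perm (Fin n)) :
    IndV (inclusion n k) (trivial ℂ (Equiv.Perm (Fin (n - k))) ℂ) :=
  IndV.mk (inclusion n k) (trivial ℂ (Equiv.Perm (Fin (n - k))) ℂ) h 1

/-- The coinvariants identify `h` with its left translates by `S_{n-k}`. The invariant of such a
coset is the restriction of `h⁻¹`, not of `h`, to the last `k` symbols. -/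
theorem indMk_inclusion_mul (g : Equiv.Perm (Fin (n - k))) (h : Equiv.Perm (Fin n)) :
    indMk n k (inclusion n k g * h) = indMk n k h := by
  have := Coinvariants.mk_self_apply
    (tprod ((leftRegular ℂ (Equiv.Perm (Fin n))).comp (inclusion n k))
      (trivial ℂ (Equiv.Perm (Fin (n - k))) ℂ)) g (MonoidAlgebra.single h 1 ⊗ₜ 1)
  simp only [Representation.tprod_apply, MonoidHom.comp_apply, TensorProduct.map_tmul,
    ofMulAction_single, smul_eq_mul, trivial_apply] at this
  exact this

theorem indMk_eq (hkn : k ≤ n) {h h' : Equiv.Perm (Fin n)}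
    (he : ∀ j, h⁻¹ (lastEmb hkn j) = h'⁻¹ (lastEmb hkn j)) : indMk n k h = indMk n k h' := by
  obtain ⟨g, hg⟩ := exists_inclusion_eq hkn (h * h'⁻¹) fun j => by
    rw [Equiv.Perm.mul_apply, ← he]
    simp
  rw [← indMk_inclusion_mul g h', hg, inv_mul_cancel_right]

/-- The map from the induced representation that restricts permutations to the last symbols. -/
def indToFinsupp (hkn : k ≤ n) :
    IndV (inclusion n k) (trivial ℂ (Equiv.Perm (Fin (n - k))) ℂ) →ₗ[ℂ]
      ((Fin k ↪ Fin n) →₀ ℂ) :=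
  Coinvariants.lift _
    (Finsupp.lmapDomain ℂ ℂ (fun h : Equiv.Perm (Fin n) =>
        (lastEmb hkn).trans h⁻¹.toEmbedding) ∘ₗ
      (MonoidAlgebra.coeffLinearEquiv ℂ).toLinearMap ∘ₗ (TensorProduct.rid ℂ _).toLinearMap)
    (fun g => by
      ext h : 4
      simp [Finsupp.mapDomain_single]
      congr 1
      ext j : 1
      simp [← map_inv, inclusion_lastEmb])

theorem indToFinsupp_indMk (hkn : k ≤ n) (h : Equiv.Perm (Fin n)) :
    indToFinsupp hkn (indMk n k h) =
      Finsupp.single ((lastEmb hkn).trans h⁻¹.toEmbedding) 1 := by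
  rw [indToFinsupp, indMk, IndV.mk, LinearMap.comp_apply, Coinvariants.lift_mk]
  simp [Finsupp.mapDomain_single]

/-- The induced representation has a basis indexed by the embeddings of `k` symbols. -/
def indEquiv (hkn : k ≤ n) :
    IndV (inclusion n k) (trivial ℂ (Equiv.Perm (Fin (n - k))) ℂ) ≃ₗ[ℂ]
      ((Fin k ↪ Fin n) →₀ ℂ) :=
  LinearEquiv.ofLinearMap (indToFinsupp hkn)
    (Finsupp.linearCombination ℂ fun e => indMk n k (extendEmb hkn e)⁻¹)
    (by
      ext1 e
      refine LinearMap.ext_ring ?_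
      change indToFinsupp hkn (Finsupp.linearCombination ℂ _ (Finsupp.single e 1)) =
        Finsupp.single e 1
      rw [Finsupp.linearCombination_single, one_smul, indToFinsupp_indMk, inv_inv,
        lastEmb_trans_extendEmb])
    (by
      refine IndV.hom_ext _ _ fun h => LinearMap.ext_ring ?_
      change Finsupp.linearCombination ℂ _ (indToFinsupp hkn (indMk n k h)) = indMk n k h
      rw [indToFinsupp_indMk, Finsupp.linearCombination_single, one_smul]
      apply indMk_eq hkn
      intro j
      rw [inv_inv]
      exact DFunLike.congr_fun (lastEmb_trans_extendEmb hkn _) j)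

/-- The basis of the induced representation that is permuted by `S_n`. -/
def indBasis (hkn : k ≤ n) : Module.Basis (Fin k ↪ Fin n) ℂ
    (IndV (inclusion n k) (trivial ℂ (Equiv.Perm (Fin (n - k))) ℂ)) :=
  Module.Basis.ofRepr (indEquiv hkn)

theorem finiteDimensional_ind (hkn : k ≤ n) : FiniteDimensional ℂ
    (IndV (inclusion n k) (trivial ℂ (Equiv.Perm (Fin (n - k))) ℂ)) :=
  Module.Finite.of_basis (indBasis hkn)

theorem indBasis_apply (hkn : k ≤ n) (e : Fin k ↪ Fin n) :
    indBasis hkn e = indMk n k (extendEmb hkn e)⁻¹ := by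
  change (indEquiv hkn).symm (Finsupp.single e 1) = _
  rw [LinearEquiv.symm_apply_eq]
  change _ = indToFinsupp hkn _
  rw [indToFinsupp_indMk, inv_inv, lastEmb_trans_extendEmb]

theorem indBasis_repr_indTrivial (hkn : k ≤ n) (g : Equiv.Perm (Fin n)) (e : Fin k ↪ Fin n) :
    (indBasis hkn).repr (indTrivial n k g (indBasis hkn e)) =
      Finsupp.single (e.trans g.toEmbedding) 1 := by
  rw [indBasis_apply, indTrivial, ind_mk]
  change indToFinsupp hkn (indMk n k _) = _
  rw [indToFinsupp_indMk]
  congr 1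
  conv_rhs => rw [← lastEmb_trans_extendEmb hkn e]
  ext j : 1
  simp

theorem card_fixed_embeddings (k : ℕ) (g : Equiv.Perm (Fin n)) :
    Fintype.card {e : Fin k ↪ Fin n // e.trans g.toEmbedding = e} =
      (Fintype.card {x // g x = x}).descFactorial k := by
  rw [← Fintype.card_fin k, ← Fintype.card_embedding_eq, Fintype.card_fin]
  refine Fintype.card_congr
    { toFun e := ⟨fun j => ⟨e.1 j, DFunLike.congr_fun e.2 j⟩, fun i j h =>
        e.1.injective (congrArg Subtype.val h)⟩
      invFun e := ⟨e.trans (Function.Embedding.subtype _), by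
        ext j : 1
        exact (e j).2⟩
      left_inv _ := rfl
      right_inv _ := rfl }

theorem character_indTrivial (hkn : k ≤ n) (g : Equiv.Perm (Fin n)) :
    (indTrivial n k).character g = (Fintype.card {x // g x = x}).descFactorial k := by
  classical
  rw [Representation.character, LinearMap.trace_eq_matrix_trace ℂ (indBasis hkn), Matrix.trace,
    ← card_fixed_embeddings, Fintype.card_subtype, Finset.card_filter, Nat.cast_sum]
  refine Finset.sum_congr rfl fun e _ => ?_
  rw [Matrix.diag_apply, LinearMap.toMatrix_apply, indBasis_repr_indTrivial,
    Finsupp.single_apply]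
  simp

end Induced

/-! ### Bounds on the normalized character and the final estimates -/

section Bounds

variable {n k : ℕ}

/-- The normalized character of the induced representation: the proportion of the embeddings of
`k` symbols that are fixed by `g`. -/
def fixedRatio (k : ℕ) (g : Equiv.Perm (Fin n)) : ℝ :=
  ((Fintype.card {x // g x = x}).descFactorial k : ℝ) / (n.descFactorial k : ℝ)

theorem descFactorial_cast_pos (hkn : k ≤ n) : 0 < (n.descFactorial k : ℝ) :=
  Nat.cast_pos.2 (Nat.descFactorial_pos.2 hkn)

theorem fixedRatio_one (hkn : k ≤ n) : fixedRatio k (1 : Equiv.Perm (Fin n)) = 1 := by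
  have : Fintype.card {x : Fin n // (1 : Equiv.Perm (Fin n)) x = x} = n := by
    simp
  rw [fixedRatio, this, div_self (descFactorial_cast_pos hkn).ne']

theorem fixedRatio_nonneg (g : Equiv.Perm (Fin n)) : 0 ≤ fixedRatio k g := by
  unfold fixedRatio
  positivity

theorem card_fixed_le {g : Equiv.Perm (Fin n)} (hg : g ≠ 1) :
    Fintype.card {x // g x = x} ≤ n - 2 := by
  have h1 := Equiv.Perm.two_le_card_support_of_ne_one hg
  have h2 : Fintype.card {x // g x = x} + g.support.card = n := by
    rw [Fintype.card_subtype, Equiv.Perm.support]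
    simpa using Finset.card_filter_add_card_filter_not (s := Finset.univ) fun x => g x = x
  omega

/-- Compute `(n)_{k+2}` in two ways: by splitting off the last two factors or the first two. For `k
= n - 1` both sides are `0`. -/
theorem beta_eq (hn : 2 ≤ n) (hkn : k < n) :
    beta n k = ((n - 2).descFactorial k : ℝ) / (n.descFactorial k : ℝ) := by
  obtain ⟨p, rfl⟩ := Nat.exists_eq_add_of_le' hn
  have h : (p + 2 - (k + 1)) * ((p + 2 - k) * (p + 2).descFactorial k) =
      (p + 2) * ((p + 1) * p.descFactorial k) := by
    rw [← Nat.descFactorial_succ, ← Nat.descFactorial_succ, Nat.succ_descFactorial_succ,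
      Nat.succ_descFactorial_succ]
  have h' := congrArg (Nat.cast (R := ℝ)) h
  rw [Nat.cast_mul, Nat.cast_mul, Nat.cast_sub hkn, Nat.cast_sub hkn.le] at h'
  have hp : (0 : ℝ) < p + 1 := by positivity
  have hd := descFactorial_cast_pos hkn.le
  rw [beta, Nat.add_sub_cancel, div_eq_div_iff _ hd.ne']
  · push_cast at h' ⊢
    linear_combination h'
  · push_cast
    have : (0 : ℝ) < (p + 2) * (p + 2 - 1) := by
      apply mul_pos <;> linarith
    exact this.ne'

theorem fixedRatio_le_beta (hn : 2 ≤ n) (hkn : k < n) {g : Equiv.Perm (Fin n)} (hg : g ≠ 1) :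
    fixedRatio k g ≤ beta n k := by
  rw [beta_eq hn hkn, fixedRatio]
  gcongr
  exact card_fixed_le hg

theorem beta_nonneg (hn : 2 ≤ n) (hkn : k < n) : 0 ≤ beta n k := by
  rw [beta_eq hn hkn]
  positivity

theorem beta_lt_one (hn : 2 ≤ n) (hk : 1 ≤ k) (hkn : k < n) : beta n k < 1 := by
  have h1 : (2 : ℝ) ≤ n := by exact_mod_cast hn
  have h2 : (1 : ℝ) ≤ k := by exact_mod_cast hk
  have h3 : (k : ℝ) + 1 ≤ n := by exact_mod_cast hkn
  rw [beta, div_lt_one (by apply mul_pos <;> linarith)]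
  nlinarith

theorem sum_fixedRatio_pow_mul_spechtChar (hkn : k ≤ n) (r : ℕ) (l : n.Partition) :
    ∑ g, fixedRatio k g ^ r * spechtChar l g =
      n.factorial * (mult l (tensorPower (indTrivial n k) r) : ℝ) /
        (n.descFactorial k : ℝ) ^ r := by
  have := finiteDimensional_ind hkn
  have h := sum_character_mul_spechtChar l (tensorPower (indTrivial n k) r)
  simp_rw [character_tensorPower, character_indTrivial hkn] at h
  have h' : ∑ g : Equiv.Perm (Fin n),
      ((Fintype.card {x // g x = x}).descFactorial k : ℝ) ^ r * spechtChar l g =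
        n.factorial * (mult l (tensorPower (indTrivial n k) r) : ℝ) := by
    exact_mod_cast h
  rw [← h', Finset.sum_div]
  refine Finset.sum_congr rfl fun g _ => ?_
  rw [fixedRatio, div_pow]
  ring

theorem weightedSum_term_le (hkn : k ≤ n) (r : ℕ) (l : n.Partition) :
    |((n.factorial : ℝ) * (mult l (tensorPower (indTrivial n k) r) : ℝ)) /
        ((dim l : ℝ) * (n.descFactorial k : ℝ) ^ r) - 1| ^ 2 * plancherel l ≤
      (∑ g, (if g = 1 then 0 else fixedRatio k g ^ r) * spechtChar l g) ^ 2 / n.factorial := by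
  have hsum : ∑ g, (if g = 1 then 0 else fixedRatio k g ^ r) * spechtChar l g =
      n.factorial * (mult l (tensorPower (indTrivial n k) r) : ℝ) /
        (n.descFactorial k : ℝ) ^ r - dim l := by
    rw [← sum_fixedRatio_pow_mul_spechtChar hkn, ← spechtChar_one,
      ← Finset.add_sum_erase _ _ (Finset.mem_univ (1 : Equiv.Perm (Fin n))),
      ← Finset.add_sum_erase Finset.univ (fun g => fixedRatio k g ^ r * spechtChar l g)
        (Finset.mem_univ (1 : Equiv.Perm (Fin n))), fixedRatio_one hkn, if_pos rfl]
    rw [one_pow, zero_mul, one_mul, zero_add, add_sub_cancel_left]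
    refine Finset.sum_congr rfl fun g hg => ?_
    rw [if_neg (Finset.ne_of_mem_erase hg)]
  -- If `dim l` were `0`, the Plancherel weight would vanish; an inequality is enough, so
  -- nonvanishing of the Specht module is not required.
  rcases Nat.eq_zero_or_pos (dim l) with hd | hd
  · rw [plancherel, hd, Nat.cast_zero, zero_pow two_ne_zero, zero_div, mul_zero]
    positivity
  · have hd' : (dim l : ℝ) ≠ 0 := Nat.cast_ne_zero.2 hd.ne'
    have hD := (pow_pos (descFactorial_cast_pos hkn) r).ne'
    rw [hsum, sq_abs, plancherel, mul_div_assoc', ← mul_pow]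
    apply le_of_eq
    congr 2
    field_simp

theorem weightedSum_le (hn : 2 ≤ n) (hkn : k < n) (r : ℕ) :
    weightedSum n k r ≤ n.factorial * beta n k ^ (2 * r) := by
  have hN : 0 < (n.factorial : ℝ) := Nat.cast_pos.2 n.factorial_pos
  calc weightedSum n k r
      ≤ ∑ l : n.Partition,
          (∑ g, (if g = 1 then 0 else fixedRatio k g ^ r) * spechtChar l g) ^ 2 / n.factorial :=
        Finset.sum_le_sum fun l _ => weightedSum_term_le hkn.le r l
    _ ≤ ∑ g : Equiv.Perm (Fin n), (if g = 1 then 0 else fixedRatio k g ^ r) ^ 2 := by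
        rw [← Finset.sum_div, div_le_iff₀' hN]
        exact sum_sq_sum_mul_spechtChar_le _
    _ ≤ ∑ _g : Equiv.Perm (Fin n), beta n k ^ (2 * r) := by
        refine Finset.sum_le_sum fun g _ => ?_
        split_ifs with hg
        · rw [zero_pow two_ne_zero]
          exact pow_nonneg (beta_nonneg hn hkn) _
        · rw [← pow_mul, mul_comm r 2]
          exact pow_le_pow_left₀ (fixedRatio_nonneg g) (fixedRatio_le_beta hn hkn hg) _
    _ = n.factorial * beta n k ^ (2 * r) := by
        rw [Finset.sum_const, Finset.card_univ, Fintype.card_perm, Fintype.card_fin, nsmul_eq_mul]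

theorem factorial_mul_pow_le (hn : 1 ≤ n) {b c : ℝ} (hb0 : 0 ≤ b) (hb1 : b < 1) (r : ℕ)
    (hr : (r : ℝ) > (n * Real.log n + c) / (2 * Real.log (1 / b))) :
    (n.factorial : ℝ) * b ^ (2 * r) ≤ Real.exp (-c) := by
  rcases hb0.eq_or_lt with rfl | hb
  -- For `b = 0` the conventions `1 / 0 = 0`, `log 0 = 0` and `x / 0 = 0` turn the hypothesis into
  -- `r > 0`. This is what makes `b ^ (2 * r)` vanish.
  · rw [div_zero, Real.log_zero, mul_zero, div_zero, gt_iff_lt, Nat.cast_pos] at hr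
    rw [zero_pow (by omega), mul_zero]
    exact (Real.exp_pos _).le
  · have hlog : 0 < 2 * Real.log (1 / b) :=
      mul_pos two_pos (Real.log_pos (by rwa [lt_div_iff₀ hb, one_mul]))
    rw [gt_iff_lt, div_lt_iff₀ hlog, one_div, Real.log_inv] at hr
    have hn0 : (0 : ℝ) < n := by exact_mod_cast hn
    calc (n.factorial : ℝ) * b ^ (2 * r)
        ≤ (n : ℝ) ^ n * b ^ (2 * r) := by
          gcongr
          exact_mod_cast Nat.factorial_le_pow n
      _ = Real.exp (n * Real.log n + (2 * r : ℕ) * Real.log b) := by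
          rw [Real.exp_add, ← Real.log_pow, ← Real.log_pow, Real.exp_log (by positivity),
            Real.exp_log (by positivity)]
      _ ≤ Real.exp (-c) := by
          apply Real.exp_le_exp.2
          push_cast
          linarith

theorem one_le_sqrt_two_mul_pi : 1 ≤ √(2 * Real.pi) := by
  rw [Real.one_le_sqrt]
  linarith [Real.pi_gt_three]

end Bounds

end SymmetricGroupRep

end

theorem mainTheorem8 (n k : ℕ) (hn : 3 ≤ n) (hk : 1 ≤ k) (hkn : k < n) :
    (∀ r : ℕ,
      SymmetricGroupRep.weightedSum n k r ≤
        (n.factorial : ℝ) * SymmetricGroupRep.beta n k ^ (2 * r)) ∧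
    (∀ (r : ℕ) (c : ℝ),
      (r : ℝ) > ((n : ℝ) * Real.log n + c) / (2 * Real.log (1 / SymmetricGroupRep.beta n k)) →
      SymmetricGroupRep.weightedSum n k r ≤ √(2 * Real.pi) * Real.exp (-c)) := by
  have hn2 : 2 ≤ n := by omega
  refine ⟨SymmetricGroupRep.weightedSum_le hn2 hkn, fun r c hr => ?_⟩
  refine (SymmetricGroupRep.weightedSum_le hn2 hkn r).trans ?_
  refine (SymmetricGroupRep.factorial_mul_pow_le (by omega)
    (SymmetricGroupRep.beta_nonneg hn2 hkn) (SymmetricGroupRep.beta_lt_one hn2 hk hkn)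
    r hr).trans ?_
  exact le_mul_of_one_le_left (Real.exp_pos _).le SymmetricGroupRep.one_le_sqrt_two_mul_pi
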